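/- Let $\tau\in\mathbb{C}$ with $\operatorname{Im}\tau>0$ and $\Lambda=\mathbb{Z}+\tau\mathbb{Z}$. For a meromorphic function $f$ on $\mathbb{C}$ put $\Delta f(x)=f(x+\tau)-f(x)$, and $T_af(x)=f(x-a)$ for $a\in\mathbb{C}$. Let $K$ be the complex vector space of quasi-elliptic functions, that is, of meromorphic functions $f$ on $\mathbb{C}$ of period $1$ with $\Delta^kf=0$ for some $k\ge 0$, and let $SK\subseteq K$ be the subspace of those functions all of whose poles lie in $\Lambda$. The operators $\Delta$ and $T_a$ descend to $K/\mathbb{C}$, the quotient by the constant functions. For $k\ge 1$ let $$K_k/\mathbb{C}=\{\hat f\in K/\mathbb{C} : \Delta^k\hat f=0\},\qquad SK_k/\mathbb{C}=\{\hat f\in SK/\mathbb{C} : \Delta^k\hat f=0\}$$ denote the kernels of $\Delta^k$ on the quotients $K/\mathbb{C}$ and $SK/\mathbb{C}$ (so $\hat f$ is in $K_k/\mathbb{C}$ if and only if $f\in K$ and $\Delta^kf$ is a constant function). Then for every $k\ge 1$ the subspace $T_a(SK_k/\mathbb{C})$ of $K/\mathbb{C}$ depends only on the class of $a$ in $\mathbb{C}/\Lambda$,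 and $K_k/\mathbb{C}$ is the internal direct sum of these subspaces: $$K_k/\mathbb{C}=\bigoplus_{a\in\mathbb{C}/\Lambda}T_a\,SK_k/\mathbb{C}.$$ -/

import Mathlib

open Filter Topology

namespace QuasiElliptic

noncomputable section

/-- The complex vector space of functions `ℂ → ℂ` that are meromorphic at every point. Values at
poles (and at finitely many points of any bounded set) carry no information; they are divided out
in `Mero`. -/
def meroFun : Submodule ℂ (ℂ → ℂ) where
  carrier := {f | Meromorphic f}
  zero_mem' := fun z => MeromorphicAt.const 0 z
  add_mem' := fun hf hg z => (hf z).add (hg z)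
  smul_mem' := fun c _ hf z => (MeromorphicAt.const c z).smul (hf z)

/-- Functions that vanish off a closed discrete set: they represent the meromorphic function `0`. -/
def nullFun : Submodule ℂ meroFun where
  carrier := {f | ∀ z : ℂ, ∀ᶠ x in 𝓝[≠] z, (f : ℂ → ℂ) x = 0}
  zero_mem' := fun _ => Eventually.of_forall fun _ => rfl
  add_mem' := fun {f g} hf hg z => by
    filter_upwards [hf z, hg z] with x h1 h2
    simp [h1, h2]
  smul_mem' := fun c f hf z => by
    filter_upwards [hf z] with x h1
    simp [h1]

/-- The complex vector space of meromorphic functions `ℂ → ℂ ∪ {∞}`, two representatives being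
identified when they agree on a punctured neighbourhood of every point. -/
abbrev Mero : Type := meroFun ⧸ nullFun

/-- The order at `z` of a meromorphic function (negative exactly at the poles). -/
def ord (F : Mero) (z : ℂ) : WithTop ℤ :=
  Quotient.liftOn' F (fun f : meroFun => meromorphicOrderAt (f : ℂ → ℂ) z) (by
    intro f g h
    have h' : f - g ∈ nullFun := (Submodule.quotientRel_def nullFun).1 h
    refine meromorphicOrderAt_congr ?_
    filter_upwards [h' z] with x hx
    exact sub_eq_zero.1 hx)

theorem ord_mk (f : meroFun) (z : ℂ) :
    ord (nullFun.mkQ f) z = meromorphicOrderAt (f : ℂ → ℂ) z := rfl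

/-- `F` has a pole at `z`. -/
def IsPole (F : Mero) (z : ℂ) : Prop := ord F z < 0

theorem meromorphic_comp_sub (a : ℂ) {f : ℂ → ℂ} (hf : Meromorphic f) :
    Meromorphic (fun x => f (x - a)) := by
  intro z
  have h : AnalyticAt ℂ (fun x : ℂ => x - a) z := analyticAt_id.sub analyticAt_const
  exact MeromorphicAt.comp_analyticAt (f := f) (hf (z - a)) h

theorem tendsto_sub_punctured (a z : ℂ) :
    Tendsto (fun x : ℂ => x - a) (𝓝[≠] z) (𝓝[≠] (z - a)) := by
  refine tendsto_nhdsWithin_iff.2 ⟨?_, ?_⟩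
  · exact ((continuous_id.sub continuous_const).tendsto z).mono_left nhdsWithin_le_nhds
  · filter_upwards [self_mem_nhdsWithin] with x hx h
    exact hx (sub_left_injective h)

/-- Translation of representatives, `f ↦ (x ↦ f (x - a))`. -/
def transFun (a : ℂ) : meroFun →ₗ[ℂ] meroFun :=
  (LinearMap.funLeft ℂ ℂ (fun x : ℂ => x - a)).restrict fun _ hf => meromorphic_comp_sub a hf

theorem transFun_null (a : ℂ) : nullFun ≤ nullFun.comap (transFun a) :=
  fun _ hf z => (tendsto_sub_punctured a z).eventually (hf (z - a))

/-- The translation `T_a` on meromorphic functions, `(T_a f)(x) = f(x - a)`. -/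
def trans (a : ℂ) : Mero →ₗ[ℂ] Mero := nullFun.mapQ nullFun (transFun a) (transFun_null a)

/-- The lattice `Λ = ℤ + τ ℤ`. -/
def lattice (τ : UpperHalfPlane) : AddSubgroup ℂ := AddSubgroup.closure {1, (τ : ℂ)}

/-- The forward difference operator `(Δ f)(x) = f(x + τ) - f(x)`. -/
def diff (τ : UpperHalfPlane) : Mero →ₗ[ℂ] Mero := trans (-(τ : ℂ)) - LinearMap.id

/-- The meromorphic functions of period `1`. -/
def periodic : Submodule ℂ Mero := LinearMap.ker (trans (-1) - LinearMap.id)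

/-- `K_k`: the meromorphic functions `f` of period `1` with `Δ^k f = 0`. -/
def K (τ : UpperHalfPlane) (k : ℕ) : Submodule ℂ Mero := periodic ⊓ LinearMap.ker (diff τ ^ k)

theorem K_mono (τ : UpperHalfPlane) : Monotone (K τ) := by
  intro m n hmn F hF
  refine ⟨hF.1, ?_⟩
  have h : (diff τ ^ m) F = 0 := hF.2
  obtain ⟨d, rfl⟩ := Nat.exists_eq_add_of_le' hmn
  change (diff τ ^ (d + m)) F = 0
  rw [pow_add, Module.End.mul_apply, h, map_zero]

/-- The space `K = ⋃ K_k` of quasi-elliptic functions. -/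
def quasiElliptic (τ : UpperHalfPlane) : Submodule ℂ Mero where
  carrier := {F | ∃ k, F ∈ K τ k}
  zero_mem' := ⟨0, zero_mem _⟩
  add_mem' := by
    rintro F G ⟨m, hF⟩ ⟨n, hG⟩
    exact ⟨max m n, add_mem (K_mono τ (le_max_left m n) hF) (K_mono τ (le_max_right m n) hG)⟩
  smul_mem' := by
    rintro c F ⟨m, hF⟩
    exact ⟨m, Submodule.smul_mem _ c hF⟩

theorem ord_add (F G : Mero) (z : ℂ) : min (ord F z) (ord G z) ≤ ord (F + G) z := by
  obtain ⟨f, rfl⟩ := Submodule.mkQ_surjective _ F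
  obtain ⟨g, rfl⟩ := Submodule.mkQ_surjective _ G
  exact meromorphicOrderAt_add (f.2 z) (g.2 z)

theorem ord_zero (z : ℂ) : ord 0 z = ⊤ :=
  meromorphicOrderAt_eq_top_iff.2 (Eventually.of_forall fun _ => rfl)

theorem ord_smul (c : ℂ) (F : Mero) (z : ℂ) : ord F z ≤ ord (c • F) z := by
  by_cases hc : c = 0
  · rw [hc, zero_smul, ord_zero]
    exact le_top
  obtain ⟨f, rfl⟩ := Submodule.mkQ_surjective _ F
  have h : meromorphicOrderAt (fun _ : ℂ => c) z = 0 := by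
    rw [meromorphicOrderAt_const, if_neg hc]
  have h2 := meromorphicOrderAt_smul (MeromorphicAt.const c z) (f.2 z)
  rw [h, zero_add] at h2
  exact h2.ge

/-- `SK`: the special quasi-elliptic functions, all of whose poles lie in `Λ`. -/
def special (τ : UpperHalfPlane) : Submodule ℂ Mero where
  carrier := {F | F ∈ quasiElliptic τ ∧ ∀ z, IsPole F z → z ∈ lattice τ}
  zero_mem' := ⟨zero_mem _, fun z hz => by simp [IsPole, ord_zero] at hz⟩
  add_mem' := by
    rintro F G ⟨hF, hF'⟩ ⟨hG, hG'⟩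
    refine ⟨add_mem hF hG, fun z hz => ?_⟩
    rcases min_lt_iff.1 ((ord_add F G z).trans_lt hz) with h | h
    · exact hF' z h
    · exact hG' z h
  smul_mem' := by
    rintro c F ⟨hF, hF'⟩
    exact ⟨Submodule.smul_mem _ c hF, fun z hz => hF' z ((ord_smul c F z).trans_lt hz)⟩

/-- The constant function `c`, as a meromorphic function. -/
def const (c : ℂ) : Mero := nullFun.mkQ ⟨fun _ => c, fun z => MeromorphicAt.const c z⟩

/-- The line `ℂ` of constant functions. -/
def constants : Submodule ℂ Mero := Submodule.span ℂ {const 1}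

theorem trans_const (a c : ℂ) : trans a (const c) = const c := rfl

theorem constants_le_trans (a : ℂ) : constants ≤ constants.comap (trans a) := by
  refine Submodule.span_le.2 ?_
  rintro _ rfl
  exact Submodule.subset_span rfl

theorem constants_le_diff (τ : UpperHalfPlane) : constants ≤ constants.comap (diff τ) := by
  intro F hF
  have h : trans (-(τ : ℂ)) F ∈ constants := constants_le_trans _ hF
  have h2 : diff τ F = trans (-(τ : ℂ)) F - F := rfl
  rw [Submodule.mem_comap, h2]
  exact Submodule.sub_mem _ h hF

/-- Meromorphic functions modulo additive constants. -/
abbrev MeroModC : Type := Mero ⧸ constants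

/-- `T_a` on classes modulo constants. -/
def transC (a : ℂ) : MeroModC →ₗ[ℂ] MeroModC :=
  constants.mapQ constants (trans a) (constants_le_trans a)

/-- `Δ` on classes modulo constants. -/
def diffC (τ : UpperHalfPlane) : MeroModC →ₗ[ℂ] MeroModC :=
  constants.mapQ constants (diff τ) (constants_le_diff τ)

/-- `K_k/ℂ`: the `k`-th step of the filtration that the operator `Δ` of `K/ℂ` defines, that is, the
classes modulo `ℂ` of quasi-elliptic functions that are annihilated by `Δ^k`. For instance the
class of the Eisenstein zeta function, whose first difference is a constant, lies in step `1`. -/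
def KModC (τ : UpperHalfPlane) (k : ℕ) : Submodule ℂ MeroModC :=
  (quasiElliptic τ).map constants.mkQ ⊓ LinearMap.ker (diffC τ ^ k)

/-- `SK_k/ℂ`: the classes modulo `ℂ` of special quasi-elliptic functions annihilated by `Δ^k`. -/
def SKModC (τ : UpperHalfPlane) (k : ℕ) : Submodule ℂ MeroModC :=
  (special τ).map constants.mkQ ⊓ LinearMap.ker (diffC τ ^ k)

end

end QuasiElliptic

/-!
The proof rests on explicit special functions. With `φ_m(x) = (e^{2πix} - 1)^{-(m+1)}` put
`ζ_{k,m}(x) = ∑_{n ∈ ℤ} (n choose k) (φ_m(x - nτ) - L_n)`, where `L_n` is the limit `(-1)^{m+1}` of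
`φ_m` at `+i∞` for `n < 0` and `0` otherwise (`zetaFun`). The terms decay exponentially in `|n|`, so
the sum is meromorphic, has period `1` and poles in `Λ` only. Pascal's rule for the weights gives
`Δ ζ_{k+1,m} = ζ_{k,m}` exactly, and `Δ ζ_{0,m} = (-1)^{m+1}` (`zetaFun_succ_add_tau`,
`zetaFun_zero_add_tau`). At the origin `ζ_{0,m}` has a pole of order exactly `m + 1`.

A quasi-elliptic function without poles is constant: by induction its difference is constant, so its
derivative is an entire elliptic function, to which Liouville's theorem applies
(`mem_constants_of_no_pole`). Directness of the sum follows, since an element common to the summand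
of one class and the sum of the others is represented by a function without poles
(`disjoint_map_polesIn`).

For the spanning part, a function `F` of period `1` with `ΔF` constant has poles that are invariant
under `Λ` and finite in number modulo `Λ`; subtracting translates of the `ζ_{0,m}` removes them one
class after the other, so `F` is a sum of such translates and a constant (`almostElliptic_le`). If
`Δ^{k+1} F` is constant this applies to `Δ^k F`. Replacing each `ζ_{0,m}` by `ζ_{k,m}` in the
resulting sum gives `H` for which `Δ^k (F - H)` is constant, and induction on `k` finishes the proof
(`KModC_le_iSup`).
-/

namespace QuasiElliptic

noncomputable section

/-! ### Translations, differences and orders -/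

/-- The class in `Mero` of a meromorphic function on `ℂ`. -/
def ofFun (f : ℂ → ℂ) (hf : Meromorphic f) : Mero := nullFun.mkQ ⟨f, hf⟩

theorem exists_ofFun (F : Mero) : ∃ f hf, F = ofFun f hf := by
  obtain ⟨f, rfl⟩ := Submodule.mkQ_surjective _ F
  exact ⟨f, f.2, rfl⟩

theorem ofFun_eq_ofFun_iff {f g : ℂ → ℂ} {hf : Meromorphic f} {hg : Meromorphic g} :
    ofFun f hf = ofFun g hg ↔ ∀ z, f =ᶠ[𝓝[≠] z] g := by
  have h : ofFun f hf = ofFun g hg ↔ (⟨f, hf⟩ - ⟨g, hg⟩ : meroFun) ∈ nullFun :=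
    Submodule.Quotient.eq nullFun
  rw [h]
  refine forall_congr' fun z => eventually_congr (Eventually.of_forall fun x => ?_)
  exact sub_eq_zero

theorem ord_ofFun (f : ℂ → ℂ) (hf : Meromorphic f) (z : ℂ) :
    ord (ofFun f hf) z = meromorphicOrderAt f z := rfl

theorem trans_ofFun (a : ℂ) (f : ℂ → ℂ) (hf : Meromorphic f) :
    trans a (ofFun f hf) = ofFun (fun x => f (x - a)) (meromorphic_comp_sub a hf) := rfl

theorem ord_trans (a : ℂ) (F : Mero) (z : ℂ) : ord (trans a F) z = ord F (z - a) := by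
  obtain ⟨f, hf, rfl⟩ := exists_ofFun F
  rw [trans_ofFun, ord_ofFun, ord_ofFun]
  exact meromorphicOrderAt_comp_sub_const_eq_meromorphicOrderAt

theorem isPole_trans {a : ℂ} {F : Mero} {z : ℂ} : IsPole (trans a F) z ↔ IsPole F (z - a) := by
  rw [IsPole, ord_trans, IsPole]

theorem trans_trans (a b : ℂ) (F : Mero) : trans a (trans b F) = trans (a + b) F := by
  obtain ⟨f, hf, rfl⟩ := exists_ofFun F
  simp only [trans_ofFun, sub_sub]

theorem trans_comm (a b : ℂ) : Commute (trans a) (trans b) := by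
  refine LinearMap.ext fun F => ?_
  rw [Module.End.mul_apply, Module.End.mul_apply, trans_trans, trans_trans, add_comm]

theorem diff_apply (τ : UpperHalfPlane) (F : Mero) : diff τ F = trans (-(τ : ℂ)) F - F := rfl

theorem commute_trans_diff_pow (τ : UpperHalfPlane) (a : ℂ) (k : ℕ) :
    Commute (trans a) (diff τ ^ k) :=
  Commute.pow_right ((trans_comm a _).sub_right (Commute.one_right _)) k

theorem diff_pow_trans (τ : UpperHalfPlane) (a : ℂ) (k : ℕ) (F : Mero) :
    (diff τ ^ k) (trans a F) = trans a ((diff τ ^ k) F) :=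
  (LinearMap.congr_fun (commute_trans_diff_pow τ a k) F).symm

theorem mem_periodic {F : Mero} : F ∈ periodic ↔ trans (-1) F = F := sub_eq_zero

theorem trans_mem_periodic {a : ℂ} {F : Mero} (hF : F ∈ periodic) : trans a F ∈ periodic := by
  rw [mem_periodic] at *
  rw [trans_trans, add_comm, ← trans_trans, hF]

theorem diff_pow_mem_periodic {τ : UpperHalfPlane} {F : Mero} (hF : F ∈ periodic) (k : ℕ) :
    (diff τ ^ k) F ∈ periodic := by
  rw [mem_periodic] at *
  rw [← diff_pow_trans, hF]

theorem trans_mem_K {τ : UpperHalfPlane} {k : ℕ} {a : ℂ} {F : Mero} (hF : F ∈ K τ k) :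
    trans a F ∈ K τ k := by
  refine ⟨trans_mem_periodic hF.1, ?_⟩
  have h : (diff τ ^ k) F = 0 := hF.2
  rw [SetLike.mem_coe, LinearMap.mem_ker, diff_pow_trans, h, map_zero]

theorem trans_mem_quasiElliptic {τ : UpperHalfPlane} {a : ℂ} {F : Mero}
    (hF : F ∈ quasiElliptic τ) : trans a F ∈ quasiElliptic τ := by
  obtain ⟨k, hk⟩ := hF
  exact ⟨k, trans_mem_K hk⟩

theorem smul_const (c d : ℂ) : c • const d = const (c * d) := rfl

theorem mem_constants {F : Mero} : F ∈ constants ↔ ∃ c, F = const c := by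
  rw [constants, Submodule.mem_span_singleton]
  simp only [smul_const, mul_one, eq_comm]

theorem const_mem_constants (c : ℂ) : const c ∈ constants := mem_constants.2 ⟨c, rfl⟩

theorem diff_const (τ : UpperHalfPlane) (c : ℂ) : diff τ (const c) = 0 := by
  rw [diff_apply, trans_const, sub_self]

/-- A function of period `1` some iterated difference of which is constant is quasi-elliptic. -/
theorem mem_quasiElliptic_of_diff_pow_mem {τ : UpperHalfPlane} {F : Mero} {k : ℕ}
    (hF : F ∈ periodic) (h : (diff τ ^ k) F ∈ constants) : F ∈ quasiElliptic τ := by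
  obtain ⟨c, hc⟩ := mem_constants.1 h
  refine ⟨k + 1, hF, ?_⟩
  rw [SetLike.mem_coe, LinearMap.mem_ker, pow_succ', Module.End.mul_apply, hc, diff_const]

theorem quasiElliptic_le_periodic (τ : UpperHalfPlane) : quasiElliptic τ ≤ periodic :=
  fun _ ⟨_, hk⟩ => hk.1

theorem not_isPole_const (c z : ℂ) : ¬ IsPole (const c) z :=
  not_lt.2 (analyticAt_const (v := c)).meromorphicOrderAt_nonneg

theorem not_isPole_of_mem_constants {F : Mero} (hF : F ∈ constants) (z : ℂ) : ¬ IsPole F z := by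
  obtain ⟨c, rfl⟩ := mem_constants.1 hF
  exact not_isPole_const c z

theorem IsPole.or_of_add {F G : Mero} {z : ℂ} (h : IsPole (F + G) z) : IsPole F z ∨ IsPole G z :=
  min_lt_iff.1 ((ord_add F G z).trans_lt h)

theorem IsPole.of_smul {c : ℂ} {F : Mero} {z : ℂ} (h : IsPole (c • F) z) : IsPole F z :=
  (ord_smul c F z).trans_lt h

theorem IsPole.or_of_sub {F G : Mero} {z : ℂ} (h : IsPole (F - G) z) : IsPole F z ∨ IsPole G z := by
  rw [sub_eq_add_neg, ← neg_one_smul ℂ G] at h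
  exact h.or_of_add.imp_right IsPole.of_smul

theorem isPole_iff_of_sub_mem_constants {F G : Mero} (h : F - G ∈ constants) (z : ℂ) :
    IsPole F z ↔ IsPole G z := by
  have h0 := not_isPole_of_mem_constants h z
  constructor <;> intro hp
  · have : IsPole (F - G + G) z := by rwa [sub_add_cancel]
    exact this.or_of_add.resolve_left h0
  · have : IsPole (F - (F - G)) z := by rwa [sub_sub_cancel]
    exact this.or_of_sub.resolve_right h0

/-! ### Classes modulo constants -/

theorem transC_mkQ (a : ℂ) (F : Mero) :
    transC a (constants.mkQ F) = constants.mkQ (trans a F) := rfl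

theorem diffC_pow_mkQ (τ : UpperHalfPlane) (k : ℕ) (F : Mero) :
    (diffC τ ^ k) (constants.mkQ F) = constants.mkQ ((diff τ ^ k) F) := by
  induction k with
  | zero => rfl
  | succ k ih => rw [pow_succ', pow_succ', Module.End.mul_apply, Module.End.mul_apply, ih]; rfl

theorem mkQ_mem_ker {τ : UpperHalfPlane} {k : ℕ} {F : Mero} :
    constants.mkQ F ∈ LinearMap.ker (diffC τ ^ k) ↔ (diff τ ^ k) F ∈ constants := by
  rw [LinearMap.mem_ker, diffC_pow_mkQ, Submodule.mkQ_apply, Submodule.Quotient.mk_eq_zero]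

theorem mem_KModC {τ : UpperHalfPlane} {k : ℕ} {x : MeroModC} :
    x ∈ KModC τ k ↔
      ∃ F, F ∈ quasiElliptic τ ∧ (diff τ ^ k) F ∈ constants ∧ constants.mkQ F = x := by
  constructor
  · rintro ⟨⟨F, hF, rfl⟩, h⟩
    exact ⟨F, hF, mkQ_mem_ker.1 h, rfl⟩
  · rintro ⟨F, hF, h, rfl⟩
    exact ⟨⟨F, hF, rfl⟩, mkQ_mem_ker.2 h⟩

theorem mem_SKModC {τ : UpperHalfPlane} {k : ℕ} {x : MeroModC} :
    x ∈ SKModC τ k ↔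
      ∃ F, F ∈ special τ ∧ (diff τ ^ k) F ∈ constants ∧ constants.mkQ F = x := by
  constructor
  · rintro ⟨⟨F, hF, rfl⟩, h⟩
    exact ⟨F, hF, mkQ_mem_ker.1 h, rfl⟩
  · rintro ⟨F, hF, h, rfl⟩
    exact ⟨⟨F, hF, rfl⟩, mkQ_mem_ker.2 h⟩

theorem SKModC_mono (τ : UpperHalfPlane) : Monotone (SKModC τ) := by
  refine monotone_nat_of_le_succ fun k x hx => ?_
  obtain ⟨F, hF, h, rfl⟩ := mem_SKModC.1 hx
  refine mem_SKModC.2 ⟨F, hF, ?_, rfl⟩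
  rw [pow_succ', Module.End.mul_apply]
  exact constants_le_diff τ h

theorem map_transC_le_of_sub_mem {τ : UpperHalfPlane} (k : ℕ) {a b : ℂ} (h : a - b ∈ lattice τ) :
    (SKModC τ k).map (transC a) ≤ (SKModC τ k).map (transC b) := by
  rintro _ ⟨x, hx, rfl⟩
  obtain ⟨F, hF, hk, rfl⟩ := mem_SKModC.1 hx
  refine ⟨constants.mkQ (trans (a - b) F), mem_SKModC.2 ⟨_, ⟨?_, fun z hz => ?_⟩, ?_, rfl⟩, ?_⟩
  · exact trans_mem_quasiElliptic hF.1
  · have := add_mem (hF.2 _ (isPole_trans.1 hz)) h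
    rwa [sub_add_cancel] at this
  · rw [diff_pow_trans]
    exact constants_le_trans _ hk
  · rw [transC_mkQ, transC_mkQ, trans_trans, add_sub_cancel]

/-- `T_a (SK_k/ℂ)` depends only on the class of `a` in `ℂ/Λ`. -/
theorem map_transC_eq_of_sub_mem {τ : UpperHalfPlane} (k : ℕ) {a b : ℂ} (h : a - b ∈ lattice τ) :
    (SKModC τ k).map (transC a) = (SKModC τ k).map (transC b) :=
  le_antisymm (map_transC_le_of_sub_mem k h)
    (map_transC_le_of_sub_mem k (by rw [← neg_sub]; exact neg_mem h))

/-! ### Model functions with poles on the lattice -/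

/-- The function `x ↦ (e^{2πix} - 1)^{-(m+1)}`, of period `1`, with a pole of order `m + 1` at each
integer, where its value is `0⁻¹ = 0`. It tends to `0` as `Im x → -∞` and to `(-1)^{m+1}` as
`Im x → +∞`. -/
def cotKernel (m : ℕ) (x : ℂ) : ℂ := (Complex.exp (2 * Real.pi * Complex.I * x) - 1)⁻¹ ^ (m + 1)

/-- The `n`-th term of `zetaFun`. The limit of `cotKernel` at `+i∞` is subtracted for negative
`n`, so that the terms decay exponentially as `n → ±∞`. -/
def zetaTerm (τ : UpperHalfPlane) (k m : ℕ) (n : ℤ) (x : ℂ) : ℂ :=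
  (Ring.choose n k : ℤ) * (cotKernel m (x - n * τ) - if n < 0 then (-1) ^ (m + 1) else 0)

/-- The function `∑ₙ (n choose k) (e^{2πi(x - nτ)} - 1)^{-(m+1)}`, regularized at `n → -∞`. It has
period `1` and its poles lie in `Λ`. For `k = m = 0` it is a multiple of the Eisenstein zeta
function, up to a constant. -/
def zetaFun (τ : UpperHalfPlane) (k m : ℕ) (x : ℂ) : ℂ := ∑' n : ℤ, zetaTerm τ k m n x

/-- `(u - 1)^{-m}` differs from its value at `u = 0` by `O(u)`; for `u = e^{2πix}` this is the
decay of the regularized kernel at `+i∞`. -/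
theorem exists_norm_inv_pow_sub_le (m : ℕ) :
    ∃ C : ℝ, ∀ u : ℂ, ‖u‖ ≤ 1 / 2 → ‖(u - 1)⁻¹ ^ m - (-1) ^ m‖ ≤ C * ‖u‖ := by
  induction m with
  | zero => exact ⟨0, fun u _ => by simp⟩
  | succ m ih =>
    obtain ⟨C, hC⟩ := ih
    refine ⟨2 * C + 2, fun u hu => ?_⟩
    have h1 : 1 / 2 ≤ ‖u - 1‖ := by
      have := norm_sub_norm_le 1 u
      rw [norm_one, norm_sub_rev] at this
      linarith
    have hne : u - 1 ≠ 0 := norm_pos_iff.1 (by linarith)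
    have h2 : ‖(u - 1)⁻¹‖ ≤ 2 := by
      rw [norm_inv]
      exact inv_le_of_inv_le₀ (by norm_num) (by linarith)
    have e : (u - 1)⁻¹ ^ (m + 1) - (-1) ^ (m + 1) =
        (u - 1)⁻¹ * ((u - 1)⁻¹ ^ m - (-1) ^ m) + (-1) ^ m * (u * (u - 1)⁻¹) := by
      have : u * (u - 1)⁻¹ = (u - 1)⁻¹ + 1 := by field_simp; ring
      rw [this]
      ring
    have hC' := hC u hu
    calc _ ≤ ‖(u - 1)⁻¹‖ * ‖(u - 1)⁻¹ ^ m - (-1) ^ m‖ + ‖u‖ * ‖(u - 1)⁻¹‖ := by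
          rw [e]
          refine (norm_add_le _ _).trans ?_
          simp only [norm_mul, norm_pow, norm_neg, norm_one, one_pow, one_mul, le_refl]
      _ ≤ 2 * (C * ‖u‖) + ‖u‖ * 2 := by gcongr
      _ = _ := by ring

theorem norm_inv_pow_succ_le (m : ℕ) {u : ℂ} (hu : 2 ≤ ‖u‖) :
    ‖(u - 1)⁻¹ ^ (m + 1)‖ ≤ 2 * ‖u‖⁻¹ := by
  have h1 : ‖u‖ / 2 ≤ ‖u - 1‖ := by
    have := norm_sub_norm_le u 1
    rw [norm_one] at this
    linarith
  have h2 : ‖(u - 1)⁻¹‖ ≤ 2 * ‖u‖⁻¹ := by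
    rw [norm_inv, ← div_eq_mul_inv, ← inv_div]
    exact inv_anti₀ (by linarith) h1
  have h3 : ‖(u - 1)⁻¹‖ ≤ 1 := by
    rw [norm_inv]
    exact inv_le_one_of_one_le₀ (by linarith)
  rw [norm_pow]
  exact (pow_le_of_le_one (norm_nonneg _) h3 (Nat.succ_ne_zero m)).trans h2

/-- The absolute value `e^{-2π Im τ}` of `q = e^{2πiτ}`. -/
def absQ (τ : UpperHalfPlane) : ℝ := Real.exp (-(2 * Real.pi * τ.im))

theorem absQ_pos (τ : UpperHalfPlane) : 0 < absQ τ := Real.exp_pos _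

theorem absQ_lt_one (τ : UpperHalfPlane) : absQ τ < 1 :=
  (Real.exp_lt_exp.2 (neg_lt_zero.2 (mul_pos Real.two_pi_pos τ.im_pos))).trans_eq Real.exp_zero

theorem norm_exp_shift (τ : UpperHalfPlane) (n : ℤ) (x : ℂ) :
    ‖Complex.exp (2 * Real.pi * Complex.I * (x - n * τ))‖ =
      Real.exp (2 * Real.pi * (-x.im + n * τ.im)) := by
  rw [Complex.norm_exp]
  congr 1
  simp
  ring

theorem absQ_pow (τ : UpperHalfPlane) (n : ℤ) :
    absQ τ ^ n.natAbs = Real.exp (-(2 * Real.pi * (|(n : ℝ)| * τ.im))) := by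
  rw [absQ, ← Real.exp_nat_mul, Nat.cast_natAbs, Int.cast_abs]
  congr 1
  ring

/-- On the strip `|Im x| ≤ R` the regularized kernels decay like `|q|^{|n|}` and have no pole, once
`|q|^{|n|}` is small compared with `e^{-2πR}`. -/
theorem exists_norm_cotKernel_sub_le (τ : UpperHalfPlane) (m : ℕ) (R : ℝ) :
    ∃ C : ℝ, ∀ n : ℤ, Real.exp (2 * Real.pi * R) * absQ τ ^ n.natAbs ≤ 1 / 2 →
      ∀ x : ℂ, |x.im| ≤ R → Complex.exp (2 * Real.pi * Complex.I * (x - n * τ)) ≠ 1 ∧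
        ‖cotKernel m (x - n * τ) - if n < 0 then (-1) ^ (m + 1) else 0‖ ≤
          C * absQ τ ^ n.natAbs := by
  obtain ⟨C, hC⟩ := exists_norm_inv_pow_sub_le (m + 1)
  refine ⟨max C 2 * Real.exp (2 * Real.pi * R), fun n hn x hx => ?_⟩
  have hpi := Real.two_pi_pos
  set u := Complex.exp (2 * Real.pi * Complex.I * (x - n * τ)) with hu
  have hnorm : ‖u‖ = Real.exp (2 * Real.pi * (-x.im + n * τ.im)) := norm_exp_shift τ n x
  rw [absQ_pow, ← Real.exp_add] at hn
  rw [absQ_pow, mul_assoc, ← Real.exp_add]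
  set E := Real.exp (2 * Real.pi * R + -(2 * Real.pi * (|(n : ℝ)| * τ.im))) with hE
  have hE0 : 0 < E := Real.exp_pos _
  have hk : cotKernel m (x - n * τ) = (u - 1)⁻¹ ^ (m + 1) := rfl
  rw [hk]
  obtain ⟨hx1, hx2⟩ := abs_le.1 hx
  split_ifs with h0
  · have hle : ‖u‖ ≤ E := by
      rw [hnorm, hE, Real.exp_le_exp, abs_of_neg (Int.cast_lt_zero.2 h0)]
      nlinarith
    refine ⟨fun h => ?_, (hC u (hle.trans hn)).trans ?_⟩
    · rw [h, norm_one] at hle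
      linarith
    · exact (mul_le_mul_of_nonneg_right (le_max_left C 2) (norm_nonneg u)).trans
        (mul_le_mul_of_nonneg_left hle (by positivity))
  · have hle : ‖u‖⁻¹ ≤ E := by
      rw [hnorm, hE, ← Real.exp_neg, Real.exp_le_exp,
        abs_of_nonneg (Int.cast_nonneg (not_lt.1 h0))]
      nlinarith
    have hu2 : 2 ≤ ‖u‖ := by
      have hpos : 0 < ‖u‖ := by rw [hnorm]; exact Real.exp_pos _
      exact (inv_le_inv₀ hpos two_pos).1 ((hle.trans hn).trans_eq (one_div 2))
    refine ⟨fun h => ?_, ?_⟩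
    · rw [h, norm_one] at hu2
      linarith
    · rw [sub_zero]
      exact (norm_inv_pow_succ_le m hu2).trans ((mul_le_mul_of_nonneg_left hle zero_le_two).trans
        (mul_le_mul_of_nonneg_right (le_max_right C 2) hE0.le))

theorem abs_choose_le (k : ℕ) (n : ℤ) : |((Ring.choose n k : ℤ) : ℝ)| ≤ (|(n : ℝ)| + k) ^ k := by
  have h1 : ((k.factorial * Ring.choose n k : ℤ) : ℝ) = ∏ j ∈ Finset.range k, ((n : ℝ) - j) := by
    have h := Ring.descPochhammer_eq_factorial_smul_choose n k
    rw [← Polynomial.eval_eq_smeval, descPochhammer_eval_eq_prod_range, nsmul_eq_mul] at h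
    rw [← h]
    push_cast
    rfl
  have h2 : |((Ring.choose n k : ℤ) : ℝ)| ≤ |((k.factorial * Ring.choose n k : ℤ) : ℝ)| := by
    push_cast
    rw [abs_mul, Nat.abs_cast]
    exact le_mul_of_one_le_left (abs_nonneg _) (Nat.one_le_cast.2 k.factorial_pos)
  refine h2.trans ?_
  rw [h1, Finset.abs_prod]
  refine (Finset.prod_le_prod (g := fun _ => |(n : ℝ)| + k) (fun j _ => abs_nonneg _)
    fun j hj => ?_).trans_eq (by rw [Finset.prod_const, Finset.card_range])
  have h3 := norm_sub_le (n : ℝ) (j : ℝ)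
  simp only [Real.norm_eq_abs, Nat.abs_cast] at h3
  refine h3.trans ?_
  gcongr
  exact (Finset.mem_range.1 hj).le

theorem summable_choose_mul_pow {r : ℝ} (h0 : 0 < r) (h1 : r < 1) (k : ℕ) :
    Summable fun n : ℤ => |((Ring.choose n k : ℤ) : ℝ)| * r ^ n.natAbs := by
  have key : Summable fun n : ℕ => ((n : ℝ) + k) ^ k * r ^ n := by
    have h := (summable_nat_add_iff k).2 (summable_pow_mul_geometric_of_norm_lt_one k
      (r := r) (by rwa [Real.norm_of_nonneg h0.le]))
    refine (h.mul_right (r ^ k)⁻¹).congr fun n => ?_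
    push_cast
    rw [pow_add]
    field_simp
  -- `|choose n k| ≤ (|n| + k)^k` for both signs of `n`.
  refine Summable.of_nat_of_neg ?_ ?_ <;>
  refine Summable.of_nonneg_of_le (fun n => by positivity) (fun n => ?_) key
  · have := abs_choose_le k n
    simp only [Int.natAbs_natCast]
    gcongr
    simpa using this
  · have := abs_choose_le k (-n)
    simp only [Int.natAbs_neg, Int.natAbs_natCast]
    gcongr
    simpa using this

/-- Normal convergence of `zetaFun` on strips, finitely many terms being set aside. -/
theorem exists_norm_zetaTerm_le (τ : UpperHalfPlane) (k m : ℕ) (R : ℝ) :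
    ∃ (S : Finset ℤ) (u : ℤ → ℝ), 0 ∈ S ∧ Summable u ∧ ∀ n ∉ S, ∀ x : ℂ, |x.im| ≤ R →
      Complex.exp (2 * Real.pi * Complex.I * (x - n * τ)) ≠ 1 ∧ ‖zetaTerm τ k m n x‖ ≤ u n := by
  obtain ⟨C, hC⟩ := exists_norm_cotKernel_sub_le τ m R
  have hlim : Tendsto (fun n : ℕ => Real.exp (2 * Real.pi * R) * absQ τ ^ n) atTop (𝓝 0) := by
    simpa using (tendsto_pow_atTop_nhds_zero_of_lt_one (absQ_pos τ).le (absQ_lt_one τ)).const_mul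
      (Real.exp (2 * Real.pi * R))
  obtain ⟨N, hN⟩ := eventually_atTop.1 (hlim.eventually_le_const (u := 1 / 2) (by norm_num))
  refine ⟨Finset.Icc (-(N : ℤ)) N, fun n => C * (|((Ring.choose n k : ℤ) : ℝ)| * absQ τ ^ n.natAbs),
    by simp, (summable_choose_mul_pow (absQ_pos τ) (absQ_lt_one τ) k).mul_left C,
    fun n hn x hx => ?_⟩
  rw [Finset.mem_Icc] at hn
  obtain ⟨h1, h2⟩ := hC n (hN n.natAbs (by omega)) x hx
  refine ⟨h1, ?_⟩
  rw [zetaTerm, norm_mul, Complex.norm_intCast]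
  exact (mul_le_mul_of_nonneg_left h2 (abs_nonneg _)).trans_eq (mul_left_comm _ _ _)

theorem summable_zetaTerm (τ : UpperHalfPlane) (k m : ℕ) (x : ℂ) :
    Summable fun n => zetaTerm τ k m n x := by
  obtain ⟨S, u, -, hu, h⟩ := exists_norm_zetaTerm_le τ k m |x.im|
  rw [← Finset.summable_compl_iff S]
  exact Summable.of_norm_bounded (hu.subtype _) fun n => (h n n.2 x le_rfl).2

theorem analyticAt_cotKernel (m : ℕ) {x : ℂ} (hx : Complex.exp (2 * Real.pi * Complex.I * x) ≠ 1) :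
    AnalyticAt ℂ (cotKernel m) x := by
  unfold cotKernel
  have : Complex.exp (2 * Real.pi * Complex.I * x) - 1 ≠ 0 := sub_ne_zero.2 hx
  fun_prop (disch := assumption)

theorem meromorphic_cotKernel (m : ℕ) : Meromorphic (cotKernel m) := by
  intro x
  unfold cotKernel
  have h : AnalyticAt ℂ (fun x => Complex.exp (2 * Real.pi * Complex.I * x) - 1) x := by fun_prop
  exact h.meromorphicAt.inv.pow _

theorem analyticAt_zetaTerm (τ : UpperHalfPlane) (k m : ℕ) {n : ℤ} {x : ℂ}
    (hx : Complex.exp (2 * Real.pi * Complex.I * (x - n * τ)) ≠ 1) :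
    AnalyticAt ℂ (zetaTerm τ k m n) x := by
  unfold zetaTerm
  have h : AnalyticAt ℂ (fun x : ℂ => cotKernel m (x - n * τ)) x :=
    (analyticAt_cotKernel m hx).comp_of_eq (f := fun x : ℂ => x - n * τ) (by fun_prop) rfl
  exact analyticAt_const.mul (h.sub analyticAt_const)

theorem meromorphic_zetaTerm (τ : UpperHalfPlane) (k m : ℕ) (n : ℤ) :
    Meromorphic (zetaTerm τ k m n) := fun x =>
  (MeromorphicAt.const _ x).mul
    ((meromorphic_comp_sub _ (meromorphic_cotKernel m) x).sub (MeromorphicAt.const _ x))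

/-- Near any point `zetaFun` is a finite partial sum of its series, plus an analytic function. -/
theorem exists_zetaFun_eq_sum_add (τ : UpperHalfPlane) (k m : ℕ) (z : ℂ) :
    ∃ (S : Finset ℤ) (g : ℂ → ℂ), 0 ∈ S ∧ AnalyticAt ℂ g z ∧
      ∀ x, zetaFun τ k m x = ∑ n ∈ S, zetaTerm τ k m n x + g x := by
  obtain ⟨S, u, h0, hu, h⟩ := exists_norm_zetaTerm_le τ k m (|z.im| + 1)
  refine ⟨S, fun x => ∑' n : {n // n ∉ S}, zetaTerm τ k m n x, h0, ?_, fun x =>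
    ((summable_zetaTerm τ k m x).sum_add_tsum_subtype_compl S).symm⟩
  have hopen : IsOpen {x : ℂ | |x.im| < |z.im| + 1} :=
    isOpen_lt (Complex.continuous_im.abs) continuous_const
  refine (Complex.differentiableOn_tsum_of_summable_norm (hu.subtype _) ?_ hopen
    fun n x hx => (h n n.2 x (le_of_lt hx)).2).analyticAt (hopen.mem_nhds (lt_add_one |z.im|))
  exact fun n x hx =>
    (analyticAt_zetaTerm τ k m (h n n.2 x (le_of_lt hx)).1).differentiableAt.differentiableWithinAt

theorem meromorphic_zetaFun (τ : UpperHalfPlane) (k m : ℕ) : Meromorphic (zetaFun τ k m) := by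
  intro z
  obtain ⟨S, g, -, hg, h⟩ := exists_zetaFun_eq_sum_add τ k m z
  rw [funext h]
  exact (MeromorphicAt.fun_sum fun n _ => meromorphic_zetaTerm τ k m n z).add hg.meromorphicAt

theorem mem_lattice_of_exp_eq_one {τ : UpperHalfPlane} {n : ℤ} {z : ℂ}
    (h : Complex.exp (2 * Real.pi * Complex.I * (z - n * τ)) = 1) : z ∈ lattice τ := by
  obtain ⟨j, hj⟩ := Complex.exp_eq_one_iff.1 h
  refine AddSubgroup.mem_closure_pair.2 ⟨j, n, ?_⟩
  have h2 : z - n * τ = j := by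
    apply mul_left_cancel₀ Complex.two_pi_I_ne_zero
    rw [hj, mul_comm]
  simp only [zsmul_eq_mul, mul_one]
  rw [← h2]
  ring

theorem analyticAt_zetaFun (τ : UpperHalfPlane) (k m : ℕ) {z : ℂ} (hz : z ∉ lattice τ) :
    AnalyticAt ℂ (zetaFun τ k m) z := by
  obtain ⟨S, g, -, hg, h⟩ := exists_zetaFun_eq_sum_add τ k m z
  rw [funext h]
  exact (Finset.analyticAt_fun_sum _ fun n _ =>
    analyticAt_zetaTerm τ k m fun h => hz (mem_lattice_of_exp_eq_one h)).add hg

theorem meromorphicOrderAt_cotKernel (m : ℕ) :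
    meromorphicOrderAt (cotKernel m) 0 = ((-(m + 1 : ℤ) : ℤ) : WithTop ℤ) := by
  set f : ℂ → ℂ := fun x => Complex.exp (2 * Real.pi * Complex.I * x) - 1 with hf
  have ha : AnalyticAt ℂ f 0 := by fun_prop
  have hd : HasDerivAt f (2 * Real.pi * Complex.I) 0 := by
    have h1 : HasDerivAt (fun x : ℂ => 2 * Real.pi * Complex.I * x) (2 * Real.pi * Complex.I) 0 := by
      simpa using (hasDerivAt_id (0 : ℂ)).const_mul (2 * Real.pi * Complex.I)
    have h2 := h1.cexp.sub_const 1
    simpa only [mul_zero, Complex.exp_zero, one_mul] using h2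
  have ho : meromorphicOrderAt f 0 = 1 := by
    have h1 : analyticOrderAt f 0 = 1 := by
      have h2 := ha.analyticOrderAt_deriv_add_one
      have h3 : analyticOrderAt (deriv f) 0 = 0 := by
        rw [ha.deriv.analyticOrderAt_eq_zero, hd.deriv]
        exact Complex.two_pi_I_ne_zero
      rw [h3] at h2
      simpa [hf] using h2.symm
    rw [ha.meromorphicOrderAt_eq, h1]
    rfl
  have e : cotKernel m = f⁻¹ ^ (m + 1) := rfl
  rw [e, meromorphicOrderAt_pow ha.meromorphicAt.inv, meromorphicOrderAt_inv, ho]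
  have : (-1 : WithTop ℤ) = ((-1 : ℤ) : WithTop ℤ) := rfl
  rw [this]
  norm_cast
  omega

/-- At `0` only the term `n = 0` of `zetaFun τ 0 m` has a pole. -/
theorem meromorphicOrderAt_zetaFun (τ : UpperHalfPlane) (m : ℕ) :
    meromorphicOrderAt (zetaFun τ 0 m) 0 = ((-(m + 1 : ℤ) : ℤ) : WithTop ℤ) := by
  obtain ⟨S, g, h0, hg, h⟩ := exists_zetaFun_eq_sum_add τ 0 m 0
  have hk : ∀ n : ℤ, n ≠ 0 → AnalyticAt ℂ (zetaTerm τ 0 m n) 0 := by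
    refine fun n hn => analyticAt_zetaTerm τ 0 m fun he => ?_
    have h1 := norm_exp_shift τ n 0
    rw [he, norm_one, eq_comm, Real.exp_eq_one_iff] at h1
    have h2 := mul_ne_zero Real.two_pi_pos.ne' (mul_ne_zero (Int.cast_ne_zero.2 hn) τ.im_ne_zero)
    simp at h1
    simp_all
  have e : zetaFun τ 0 m = cotKernel m + fun x => ∑ n ∈ S.erase 0, zetaTerm τ 0 m n x + g x := by
    funext x
    rw [h x, ← Finset.add_sum_erase S _ h0, Pi.add_apply, add_assoc]
    congr 1
    simp [zetaTerm]
  have ha : AnalyticAt ℂ (fun x => ∑ n ∈ S.erase 0, zetaTerm τ 0 m n x + g x) 0 :=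
    (Finset.analyticAt_fun_sum _ fun n hn => hk n (Finset.ne_of_mem_erase hn)).add hg
  rw [e, meromorphicOrderAt_add_eq_left_of_lt ha.meromorphicAt, meromorphicOrderAt_cotKernel]
  rw [meromorphicOrderAt_cotKernel]
  refine lt_of_lt_of_le ?_ ha.meromorphicOrderAt_nonneg
  exact_mod_cast (by omega : (-(m + 1 : ℤ)) < 0)

theorem zetaFun_add_one (τ : UpperHalfPlane) (k m : ℕ) (x : ℂ) :
    zetaFun τ k m (x + 1) = zetaFun τ k m x := by
  have h : ∀ x : ℂ, cotKernel m (x + 1) = cotKernel m x := fun x => by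
    rw [cotKernel, mul_add, mul_one, Complex.exp_periodic, cotKernel]
  refine tsum_congr fun n => ?_
  rw [zetaTerm, zetaTerm, add_sub_right_comm, h]

/-- Shifting `x` by `τ` shifts the summation index; the regularization contributes at `n = -1`. -/
theorem zetaTerm_add_tau (τ : UpperHalfPlane) (k m : ℕ) (n : ℤ) (x : ℂ) :
    zetaTerm τ k m (n + 1) (x + τ) =
      ((Ring.choose (n + 1) k : ℤ) : ℂ) *
        (cotKernel m (x - n * τ) - if n < 0 then (-1) ^ (m + 1) else 0) +
        if n = -1 then ((Ring.choose (0 : ℤ) k : ℤ) : ℂ) * (-1) ^ (m + 1) else 0 := by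
  have e : x + τ - (n + 1 : ℤ) * τ = x - n * τ := by push_cast; ring
  rw [zetaTerm, e]
  rcases lt_trichotomy n (-1) with h | rfl | h
  · rw [if_pos (by omega), if_pos (by omega), if_neg (by omega), add_zero]
  · simp
    ring
  · rw [if_neg (by omega), if_neg (by omega), if_neg (by omega), add_zero]

/-- Pascal's rule: the difference operator lowers the degree of the weights. -/
theorem zetaFun_succ_add_tau (τ : UpperHalfPlane) (k m : ℕ) (x : ℂ) :
    zetaFun τ (k + 1) m (x + τ) = zetaFun τ (k + 1) m x + zetaFun τ k m x := by
  rw [zetaFun, ← (Equiv.addRight (1 : ℤ)).tsum_eq, zetaFun, zetaFun,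
    ← (summable_zetaTerm τ (k + 1) m x).tsum_add (summable_zetaTerm τ k m x)]
  refine tsum_congr fun n => ?_
  rw [Equiv.coe_addRight, zetaTerm_add_tau, Ring.choose_succ_succ, Ring.choose_zero_succ, zetaTerm,
    zetaTerm]
  push_cast
  simp
  ring

theorem zetaFun_zero_add_tau (τ : UpperHalfPlane) (m : ℕ) (x : ℂ) :
    zetaFun τ 0 m (x + τ) = zetaFun τ 0 m x + (-1) ^ (m + 1) := by
  have h : ∑' n : ℤ, (if n = -1 then ((-1) ^ (m + 1) : ℂ) else 0) = (-1) ^ (m + 1) :=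
    tsum_ite_eq _ _
  rw [← h, zetaFun, ← (Equiv.addRight (1 : ℤ)).tsum_eq, zetaFun,
    ← (summable_zetaTerm τ 0 m x).tsum_add (hasSum_ite_eq (-1 : ℤ) ((-1) ^ (m + 1) : ℂ)).summable]
  refine tsum_congr fun n => ?_
  rw [Equiv.coe_addRight, zetaTerm_add_tau, zetaTerm]
  simp

/-! ### Quasi-elliptic functions without poles -/

/-- The closed parallelogram spanned by `1` and `τ`. -/
def cell (τ : UpperHalfPlane) : Set ℂ :=
  (fun p : ℝ × ℝ => (p.1 : ℂ) + p.2 * τ) '' (Set.Icc 0 1 ×ˢ Set.Icc 0 1)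

theorem isCompact_cell (τ : UpperHalfPlane) : IsCompact (cell τ) :=
  (isCompact_Icc.prod isCompact_Icc).image (by fun_prop)

theorem exists_mem_cell (τ : UpperHalfPlane) (x : ℂ) :
    ∃ y ∈ cell τ, ∃ m n : ℤ, x = y + m + n * τ := by
  set t : ℝ := x.im / τ.im
  set s : ℝ := x.re - t * τ.re
  have hx : x = s + t * τ := by
    apply Complex.ext
    · simp [s]
    · simp [t, τ.im_ne_zero]
  refine ⟨(Int.fract s : ℝ) + (Int.fract t : ℝ) * τ, ⟨(Int.fract s, Int.fract t),
    ⟨⟨Int.fract_nonneg s, (Int.fract_lt_one s).le⟩,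
      ⟨Int.fract_nonneg t, (Int.fract_lt_one t).le⟩⟩, rfl⟩, ⌊s⌋, ⌊t⌋, ?_⟩
  rw [hx]
  conv_lhs => rw [← Int.floor_add_fract s, ← Int.floor_add_fract t]
  push_cast
  ring

/-- A meromorphic function without poles is represented by an entire function. -/
theorem exists_entire {F : Mero} (hF : ∀ z, ¬ IsPole F z) :
    ∃ (f : ℂ → ℂ) (hf : Meromorphic f), Differentiable ℂ f ∧ F = ofFun f hf := by
  obtain ⟨f, hf, rfl⟩ := exists_ofFun F
  have hU : MeromorphicOn f Set.univ := fun z _ => hf z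
  have han : ∀ z, AnalyticAt ℂ (toMeromorphicNFOn f Set.univ) z := fun z => by
    rw [← (meromorphicNFOn_toMeromorphicNFOn f Set.univ
      (Set.mem_univ z)).meromorphicOrderAt_nonneg_iff_analyticAt,
      meromorphicOrderAt_toMeromorphicNFOn hU (Set.mem_univ z)]
    exact not_lt.1 (hF z)
  exact ⟨toMeromorphicNFOn f Set.univ, fun z => (han z).meromorphicAt,
    fun z => (han z).differentiableAt,
    ofFun_eq_ofFun_iff.2 fun z =>
      (hU.toMeromorphicNFOn_eq_self_on_nhdsNE (Set.mem_univ z)).symm⟩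

theorem eq_of_ofFun_eq {f g : ℂ → ℂ} {hf : Meromorphic f} {hg : Meromorphic g}
    (h : ofFun f hf = ofFun g hg) (hfc : Continuous f) (hgc : Continuous g) : f = g := by
  funext z
  have h1 := ofFun_eq_ofFun_iff.1 h z
  have h2 := (hfc.tendsto z).mono_left (nhdsWithin_le_nhds (s := {z}ᶜ))
  exact tendsto_nhds_unique (h2.congr' h1) ((hgc.tendsto z).mono_left nhdsWithin_le_nhds)

theorem apply_add_int_mul {f : ℂ → ℂ} {w : ℂ} (h : ∀ x, f (x + w) = f x) (n : ℤ) (x : ℂ) :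
    f (x + n * w) = f x := by
  have : Function.Periodic f w := h
  simpa using this.int_mul n x

/-- Liouville's theorem for the derivative: an entire function of period `1` whose difference
is constant is itself constant. -/
theorem eq_const_of_differentiable {τ : UpperHalfPlane} {f : ℂ → ℂ} (hf : Differentiable ℂ f)
    (h1 : ∀ x, f (x + 1) = f x) {c : ℂ} (hτ : ∀ x, f (x + τ) = f x + c) (x : ℂ) : f x = f 0 := by
  have hd1 : ∀ x, deriv f (x + 1) = deriv f x := fun x => by
    rw [← deriv_comp_add_const, funext h1]
  -- `f'` is doubly periodic, hence bounded, hence constant; so `f` is affine, and period `1`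
  -- excludes a nonzero slope.
  have hdτ : ∀ x, deriv f (x + τ) = deriv f x := fun x => by
    rw [← deriv_comp_add_const, funext hτ, deriv_add_const]
  have hb : Bornology.IsBounded (Set.range (deriv f)) := by
    refine ((isCompact_cell τ).image hf.deriv.continuous).isBounded.subset ?_
    rintro _ ⟨x, rfl⟩
    obtain ⟨y, hy, m, n, rfl⟩ := exists_mem_cell τ x
    refine ⟨y, hy, ?_⟩
    have := apply_add_int_mul hd1 m y
    rw [mul_one] at this
    rw [apply_add_int_mul hdτ, this]
  have hconst : ∀ x, deriv f x = deriv f 0 := fun x => hf.deriv.apply_eq_apply_of_bounded hb x 0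
  have hlin : ∀ x, f x - deriv f 0 * x = f 0 - deriv f 0 * 0 := fun x => by
    refine is_const_of_deriv_eq_zero (f := fun x => f x - deriv f 0 * x) (by fun_prop)
      (fun x => ?_) x 0
    have h := (hf x).hasDerivAt.sub ((hasDerivAt_id x).const_mul (deriv f 0))
    have h2 := h.deriv
    rw [mul_one, hconst x, sub_self] at h2
    exact h2
  have hz : deriv f 0 = 0 := by
    have ha := hlin 1
    have hb := h1 0
    rw [zero_add] at hb
    rw [hb] at ha
    simpa using ha
  simpa [hz] using hlin x

theorem mem_constants_of_no_pole_of_diff_mem {τ : UpperHalfPlane} {F : Mero} (hF : F ∈ periodic)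
    (hd : diff τ F ∈ constants) (hp : ∀ z, ¬ IsPole F z) : F ∈ constants := by
  obtain ⟨f, hf, hfd, rfl⟩ := exists_entire hp
  obtain ⟨c, hc⟩ := mem_constants.1 hd
  rw [diff_apply, sub_eq_iff_eq_add] at hc
  have hfc := hfd.continuous
  have e1 : (fun x => f (x - -1)) = f :=
    eq_of_ofFun_eq (hf := meromorphic_comp_sub _ hf) (mem_periodic.1 hF) (by fun_prop) hfc
  have e2 : (fun x => f (x - -(τ : ℂ))) = fun x => c + f x :=
    eq_of_ofFun_eq (hf := meromorphic_comp_sub _ hf)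
      (hg := fun z => (MeromorphicAt.const c z).add (hf z)) hc (by fun_prop) (by fun_prop)
  have h := eq_const_of_differentiable (τ := τ) (c := c) hfd
    (fun x => by simpa using congrFun e1 x)
    (fun x => by simpa [add_comm] using congrFun e2 x)
  refine mem_constants.2 ⟨f 0, ?_⟩
  exact ofFun_eq_ofFun_iff.2 fun z => Eventually.of_forall h

theorem not_isPole_diff {τ : UpperHalfPlane} {F : Mero} (hp : ∀ z, ¬ IsPole F z) (z : ℂ) :
    ¬ IsPole (diff τ F) z := fun h =>
  h.or_of_sub.elim (fun h => hp _ (isPole_trans.1 h)) (hp z)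

theorem mem_constants_of_no_pole {τ : UpperHalfPlane} {F : Mero} (hF : F ∈ quasiElliptic τ)
    (hp : ∀ z, ¬ IsPole F z) : F ∈ constants := by
  obtain ⟨k, hk⟩ := hF
  induction k generalizing F with
  | zero =>
    have h : F = 0 := hk.2
    rw [h]
    exact zero_mem _
  | succ k ih =>
    refine mem_constants_of_no_pole_of_diff_mem (τ := τ) hk.1 (ih (not_isPole_diff hp) ⟨?_, ?_⟩) hp
    · simpa using diff_pow_mem_periodic (τ := τ) hk.1 1
    · exact hk.2

/-! ### Finiteness of the poles modulo the lattice -/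

theorem finite_inter_isPole (F : Mero) {s : Set ℂ} (hs : IsCompact s) :
    (s ∩ {z | IsPole F z}).Finite := by
  obtain ⟨f, hf, rfl⟩ := exists_ofFun F
  refine hs.induction_on (p := fun t => (t ∩ {z | IsPole (ofFun f hf) z}).Finite) (by simp)
    (fun s t hst ht => ht.subset (Set.inter_subset_inter_left _ hst))
    (fun s t hs ht => by rw [Set.union_inter_distrib_right]; exact hs.union ht) fun z _ => ?_
  obtain ⟨t, ht, h⟩ := (eventually_nhdsWithin_iff.1 (hf z).eventually_analyticAt).exists_mem
  refine ⟨t, mem_nhdsWithin_of_mem_nhds ht, (Set.finite_singleton z).subset ?_⟩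
  rintro w ⟨hw, hp⟩
  by_contra hne
  exact not_lt.2 (h w hw hne).meromorphicOrderAt_nonneg hp

/-- The functions of period `1` whose difference is constant. Their derivatives are elliptic. -/
def almostElliptic (τ : UpperHalfPlane) : Submodule ℂ Mero :=
  periodic ⊓ constants.comap (diff τ)

theorem mem_lattice (τ : UpperHalfPlane) (m n : ℤ) : (m : ℂ) + n * τ ∈ lattice τ :=
  AddSubgroup.mem_closure_pair.2 ⟨m, n, by simp⟩

theorem isPole_iff_of_sub_mem_lattice {τ : UpperHalfPlane} {F : Mero} (hF : F ∈ almostElliptic τ)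
    {a b : ℂ} (h : a - b ∈ lattice τ) : IsPole F a ↔ IsPole F b := by
  have h1 : ∀ z, IsPole F (z + 1) = IsPole F z := fun z => by
    have := isPole_trans (a := -1) (F := F) (z := z)
    rw [mem_periodic.1 hF.1, sub_neg_eq_add] at this
    exact propext this.symm
  have h2 : ∀ z, IsPole F (z + τ) = IsPole F z := fun z => by
    have := isPole_trans (a := -(τ : ℂ)) (F := F) (z := z)
    rw [isPole_iff_of_sub_mem_constants (G := F) hF.2, sub_neg_eq_add] at this
    exact propext this.symm
  obtain ⟨m, n, hmn⟩ := AddSubgroup.mem_closure_pair.1 h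
  have e : a = b + m * 1 + n * τ := by
    rw [zsmul_eq_mul, zsmul_eq_mul] at hmn
    linear_combination -hmn
  have h3 : Function.Periodic (IsPole F) 1 := h1
  have h4 : Function.Periodic (IsPole F) τ := h2
  rw [e, h4.int_mul n, h3.int_mul m]

theorem finite_pole_classes {τ : UpperHalfPlane} {F : Mero} (hF : F ∈ almostElliptic τ) :
    ((QuotientAddGroup.mk : ℂ → ℂ ⧸ lattice τ) '' {z | IsPole F z}).Finite := by
  refine ((finite_inter_isPole F (isCompact_cell τ)).image QuotientAddGroup.mk).subset ?_
  rintro _ ⟨x, hx, rfl⟩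
  obtain ⟨y, hy, m, n, rfl⟩ := exists_mem_cell τ x
  have h : y + m + n * τ - y ∈ lattice τ := by
    rw [add_assoc, add_sub_cancel_left]
    exact mem_lattice τ m n
  refine ⟨y, ⟨hy, (isPole_iff_of_sub_mem_lattice hF h).1 hx⟩, ?_⟩
  rw [QuotientAddGroup.eq, neg_add_eq_sub]
  exact h

/-! ### The special functions attached to the model functions -/

/-- The class of `zetaFun` in `Mero`. -/
def zeta (τ : UpperHalfPlane) (k m : ℕ) : Mero := ofFun (zetaFun τ k m) (meromorphic_zetaFun τ k m)

theorem zeta_mem_periodic (τ : UpperHalfPlane) (k m : ℕ) : zeta τ k m ∈ periodic := by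
  refine mem_periodic.2 (ofFun_eq_ofFun_iff.2 fun z => Eventually.of_forall fun x => ?_)
  simpa using zetaFun_add_one τ k m x

theorem diff_zeta_succ (τ : UpperHalfPlane) (k m : ℕ) :
    diff τ (zeta τ (k + 1) m) = zeta τ k m := by
  rw [diff_apply, sub_eq_iff_eq_add']
  refine ofFun_eq_ofFun_iff (hg := fun z => (meromorphic_zetaFun τ (k + 1) m z).add
    (meromorphic_zetaFun τ k m z)).2 fun z => Eventually.of_forall fun x => ?_
  simpa using zetaFun_succ_add_tau τ k m x

theorem diff_zeta_zero (τ : UpperHalfPlane) (m : ℕ) :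
    diff τ (zeta τ 0 m) = const ((-1) ^ (m + 1)) := by
  rw [diff_apply, sub_eq_iff_eq_add']
  refine ofFun_eq_ofFun_iff (hg := fun z => (meromorphic_zetaFun τ 0 m z).add
    (MeromorphicAt.const ((-1) ^ (m + 1)) z)).2 fun z => Eventually.of_forall fun x => ?_
  simpa using zetaFun_zero_add_tau τ m x

theorem diff_pow_zeta (τ : UpperHalfPlane) (k m : ℕ) :
    (diff τ ^ k) (zeta τ k m) = zeta τ 0 m := by
  induction k with
  | zero => rfl
  | succ k ih => rw [pow_succ, Module.End.mul_apply, diff_zeta_succ, ih]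

theorem diff_pow_succ_zeta_mem (τ : UpperHalfPlane) (k m : ℕ) :
    (diff τ ^ (k + 1)) (zeta τ k m) ∈ constants := by
  rw [pow_succ', Module.End.mul_apply, diff_pow_zeta, diff_zeta_zero]
  exact const_mem_constants _

theorem mem_lattice_of_isPole_zeta {τ : UpperHalfPlane} {k m : ℕ} {z : ℂ}
    (h : IsPole (zeta τ k m) z) : z ∈ lattice τ := by
  by_contra hz
  exact not_lt.2 (analyticAt_zetaFun τ k m hz).meromorphicOrderAt_nonneg h

theorem zeta_mem_special (τ : UpperHalfPlane) (k m : ℕ) : zeta τ k m ∈ special τ :=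
  ⟨mem_quasiElliptic_of_diff_pow_mem (zeta_mem_periodic τ k m) (diff_pow_succ_zeta_mem τ k m),
    fun _ => mem_lattice_of_isPole_zeta⟩

/-- The span of the translates `T_a ζ_{k,m}`, `m ≥ 0`. -/
def zetaSpan (τ : UpperHalfPlane) (k : ℕ) (a : ℂ) : Submodule ℂ Mero :=
  Submodule.span ℂ (Set.range fun m => trans a (zeta τ k m))

theorem zetaSpan_le_almostElliptic (τ : UpperHalfPlane) (a : ℂ) :
    zetaSpan τ 0 a ≤ almostElliptic τ := by
  refine Submodule.span_le.2 ?_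
  rintro _ ⟨m, rfl⟩
  refine ⟨trans_mem_periodic (zeta_mem_periodic τ 0 m), ?_⟩
  have h := diff_pow_trans τ a 1 (zeta τ 0 m)
  rw [pow_one, diff_zeta_zero, trans_const] at h
  change diff τ _ ∈ constants
  rw [h]
  exact const_mem_constants _

theorem zetaSpan_le_quasiElliptic (τ : UpperHalfPlane) (k : ℕ) (a : ℂ) :
    zetaSpan τ k a ≤ quasiElliptic τ := by
  refine Submodule.span_le.2 ?_
  rintro _ ⟨m, rfl⟩
  exact trans_mem_quasiElliptic (zeta_mem_special τ k m).1

theorem mkQ_mem_of_mem_zetaSpan {τ : UpperHalfPlane} {k : ℕ} {a : ℂ} {F : Mero}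
    (hF : F ∈ zetaSpan τ k a) : constants.mkQ F ∈ (SKModC τ (k + 1)).map (transC a) := by
  have h : zetaSpan τ k a ≤ ((SKModC τ (k + 1)).map (transC a)).comap constants.mkQ := by
    refine Submodule.span_le.2 ?_
    rintro _ ⟨m, rfl⟩
    exact ⟨constants.mkQ (zeta τ k m),
      mem_SKModC.2 ⟨_, zeta_mem_special τ k m, diff_pow_succ_zeta_mem τ k m, rfl⟩, rfl⟩
  exact h hF

theorem map_diff_pow_zetaSpan (τ : UpperHalfPlane) (k : ℕ) (a : ℂ) :
    (zetaSpan τ k a).map (diff τ ^ k) = zetaSpan τ 0 a := by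
  rw [zetaSpan, Submodule.map_span, ← Set.range_comp, zetaSpan]
  congr 2
  funext m
  rw [Function.comp_apply, diff_pow_trans, diff_pow_zeta]

theorem sub_mem_lattice_of_isPole {τ : UpperHalfPlane} {k : ℕ} {a z : ℂ} {F : Mero}
    (hF : F ∈ zetaSpan τ k a) (h : IsPole F z) : z - a ∈ lattice τ := by
  induction hF using Submodule.span_induction with
  | mem F hF =>
    obtain ⟨m, rfl⟩ := hF
    exact mem_lattice_of_isPole_zeta (isPole_trans.1 h)
  | zero => exact absurd h (not_isPole_of_mem_constants (zero_mem _) z)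
  | add F G _ _ hF hG => exact h.or_of_add.elim hF hG
  | smul c F _ hF => exact hF h.of_smul

theorem ord_trans_zeta (τ : UpperHalfPlane) (m : ℕ) (a : ℂ) :
    ord (trans a (zeta τ 0 m)) a = ((-(m + 1 : ℤ) : ℤ) : WithTop ℤ) := by
  rw [ord_trans, sub_self, zeta, ord_ofFun, meromorphicOrderAt_zetaFun]

/-! ### Removing poles -/

theorem eq_top_or_exists_eq_coe (x : WithTop ℤ) : x = ⊤ ∨ ∃ n : ℤ, x = n := by
  cases x with
  | top => exact Or.inl rfl
  | coe n => exact Or.inr ⟨n, rfl⟩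

/-- Two functions of the same finite order at `a` have leading coefficients there, and a suitable
multiple of the one cancels the leading term of the other. -/
theorem exists_lt_ord_sub_smul {F G : Mero} {a : ℂ} {n : ℤ} (hF : ord F a = n) (hG : ord G a = n) :
    ∃ c : ℂ, n < ord (F - c • G) a := by
  obtain ⟨f, hf, rfl⟩ := exists_ofFun F
  obtain ⟨g, hg, rfl⟩ := exists_ofFun G
  obtain ⟨u, hu, -, hfu⟩ := (meromorphicOrderAt_eq_int_iff (hf a)).1 hF
  obtain ⟨v, hv, hv0, hgv⟩ := (meromorphicOrderAt_eq_int_iff (hg a)).1 hG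
  refine ⟨u a / v a, ?_⟩
  set c := u a / v a with hc
  have hw : AnalyticAt ℂ (fun x => u x - c * v x) a := hu.sub (analyticAt_const.mul hv)
  have hpos : 0 < meromorphicOrderAt (fun x => u x - c * v x) a := by
    refine (tendsto_zero_iff_meromorphicOrderAt_pos hw.meromorphicAt).1 ?_
    have h := hw.continuousAt.tendsto.mono_left (nhdsWithin_le_nhds (s := {a}ᶜ))
    have h0 : u a - c * v a = 0 := by rw [hc, div_mul_cancel₀ _ hv0, sub_self]
    rwa [h0] at h
  have hp : MeromorphicAt (fun x : ℂ => (x - a) ^ n) a :=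
    ((MeromorphicAt.id a).sub (MeromorphicAt.const a a)).zpow n
  have e : ord (ofFun f hf - c • ofFun g hg) a =
      meromorphicOrderAt ((fun x => (x - a) ^ n) * fun x => u x - c * v x) a := by
    change meromorphicOrderAt (fun x => f x - c • g x) a = _
    refine meromorphicOrderAt_congr ?_
    filter_upwards [hfu, hgv] with x h1 h2
    simp only [h1, h2, Pi.mul_apply, smul_eq_mul]
    ring
  rw [e, meromorphicOrderAt_mul hp hw.meromorphicAt,
    fun_meromorphicOrderAt_zpow_id_sub_const]
  obtain h | ⟨j, h⟩ := eq_top_or_exists_eq_coe (meromorphicOrderAt (fun x => u x - c * v x) a)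
  · rw [h, WithTop.add_top]
    exact WithTop.coe_lt_top n
  · rw [h] at hpos ⊢
    norm_cast at hpos ⊢
    omega

theorem exists_sub_not_isPole_of_le (τ : UpperHalfPlane) (a : ℂ) (N : ℕ) {F : Mero}
    (hF : ((-(N : ℤ) : ℤ) : WithTop ℤ) ≤ ord F a) :
    ∃ H ∈ zetaSpan τ 0 a, ¬ IsPole (F - H) a := by
  induction N generalizing F with
  | zero => exact ⟨0, zero_mem _, by rw [sub_zero]; exact not_lt.2 (by simpa using hF)⟩
  | succ N ih =>
    by_cases h : ((-(N : ℤ) : ℤ) : WithTop ℤ) ≤ ord F a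
    · exact ih h
    obtain ⟨j, hj⟩ := WithTop.ne_top_iff_exists.1 (not_le.1 h).ne_top
    have hj' : ord F a = ((-(N + 1 : ℤ) : ℤ) : WithTop ℤ) := by
      rw [← hj] at hF h ⊢
      norm_cast at hF h ⊢
      omega
    -- The pole has order exactly `N + 1`, as `ζ_{0,N}` has, so one multiple lowers it.
    obtain ⟨c, hc⟩ := exists_lt_ord_sub_smul hj' (ord_trans_zeta τ N a)
    have hle : ((-(N : ℤ) : ℤ) : WithTop ℤ) ≤ ord (F - c • trans a (zeta τ 0 N)) a := by
      obtain h' | ⟨i, h'⟩ := eq_top_or_exists_eq_coe (ord (F - c • trans a (zeta τ 0 N)) a)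
      · rw [h']
        exact le_top
      · rw [h'] at hc ⊢
        rw [WithTop.coe_lt_coe] at hc
        rw [WithTop.coe_le_coe]
        omega
    obtain ⟨H, hH, hp⟩ := ih hle
    refine ⟨c • trans a (zeta τ 0 N) + H,
      add_mem (Submodule.smul_mem _ c (Submodule.subset_span ⟨N, rfl⟩)) hH, ?_⟩
    rwa [← sub_sub]

theorem exists_sub_not_isPole (τ : UpperHalfPlane) (a : ℂ) (F : Mero) :
    ∃ H ∈ zetaSpan τ 0 a, ¬ IsPole (F - H) a := by
  obtain h | ⟨n, h⟩ := eq_top_or_exists_eq_coe (ord F a)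
  · exact exists_sub_not_isPole_of_le τ a 0 (by rw [h]; exact le_top)
  · refine exists_sub_not_isPole_of_le τ a n.natAbs ?_
    rw [h, WithTop.coe_le_coe]
    omega

/-- The poles, finite in number modulo the lattice, are removed one class after the other. -/
theorem mem_sup_of_pole_classes_subset {τ : UpperHalfPlane} {S : Set (ℂ ⧸ lattice τ)}
    (hS : S.Finite) {F : Mero} (hF : F ∈ almostElliptic τ)
    (h : ∀ z, IsPole F z → (QuotientAddGroup.mk z : ℂ ⧸ lattice τ) ∈ S) :
    F ∈ constants ⊔ ⨆ a, zetaSpan τ 0 a := by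
  induction S, hS using Set.Finite.induction_on generalizing F with
  | empty =>
    exact Submodule.mem_sup_left (mem_constants_of_no_pole_of_diff_mem hF.1 hF.2 h)
  | @insert s S _ _ ih =>
    obtain ⟨a, rfl⟩ := QuotientAddGroup.mk_surjective s
    obtain ⟨H, hH, hp⟩ := exists_sub_not_isPole τ a F
    have hFH : F - H ∈ almostElliptic τ := sub_mem hF (zetaSpan_le_almostElliptic τ a hH)
    have hmk : ∀ z : ℂ, (z : ℂ ⧸ lattice τ) = a ↔ z - a ∈ lattice τ := fun z => by
      rw [eq_comm, QuotientAddGroup.eq, neg_add_eq_sub]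
    have key := ih hFH fun z hz => by
      have hza : (z : ℂ ⧸ lattice τ) ≠ a := fun e =>
        hp ((isPole_iff_of_sub_mem_lattice hFH ((hmk z).1 e)).1 hz)
      refine (hz.or_of_sub.elim (h z) fun h' => ?_).resolve_left hza
      exact Or.inl ((hmk z).2 (sub_mem_lattice_of_isPole hH h'))
    rw [← sub_add_cancel F H]
    exact add_mem key (Submodule.mem_sup_right (Submodule.mem_iSup_of_mem a hH))

theorem almostElliptic_le (τ : UpperHalfPlane) :
    almostElliptic τ ≤ constants ⊔ ⨆ a, zetaSpan τ 0 a := fun _ hF =>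
  mem_sup_of_pole_classes_subset (finite_pole_classes hF) hF fun z hz => ⟨z, hz, rfl⟩

/-! ### The decomposition -/

/-- Descent on `k`: `Δ^k F` has constant difference, so it is a sum of translates of `ζ_{0,m}`, up
to a constant; these lift along `Δ^k` to the translates of `ζ_{k,m}`. -/
theorem KModC_le_iSup (τ : UpperHalfPlane) (k : ℕ) :
    KModC τ k ≤ ⨆ a, (SKModC τ k).map (transC a) := by
  induction k with
  | zero =>
    intro x hx
    obtain ⟨F, -, h, rfl⟩ := mem_KModC.1 hx
    have h0 : constants.mkQ F = 0 := (Submodule.Quotient.mk_eq_zero _).2 h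
    rw [h0]
    exact zero_mem _
  | succ k ih =>
    intro x hx
    obtain ⟨F, hF, h, rfl⟩ := mem_KModC.1 hx
    have hd : (diff τ ^ k) F ∈ almostElliptic τ := by
      refine ⟨diff_pow_mem_periodic (quasiElliptic_le_periodic τ hF) k, ?_⟩
      rw [pow_succ', Module.End.mul_apply] at h
      exact h
    obtain ⟨C, hC, U, hU, hCU⟩ := Submodule.mem_sup.1 (almostElliptic_le τ hd)
    have hU' : U ∈ (⨆ a, zetaSpan τ k a).map (diff τ ^ k) := by
      rw [Submodule.map_iSup]
      simpa only [map_diff_pow_zetaSpan] using hU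
    obtain ⟨H, hH, rfl⟩ := hU'
    have hHq : H ∈ quasiElliptic τ := iSup_le (zetaSpan_le_quasiElliptic τ k) hH
    have h1 : constants.mkQ (F - H) ∈ KModC τ k := by
      refine mem_KModC.2 ⟨F - H, sub_mem hF hHq, ?_, rfl⟩
      rwa [map_sub, ← hCU, add_sub_cancel_right]
    have h2 : constants.mkQ H ∈ ⨆ a, (SKModC τ (k + 1)).map (transC a) := by
      have hle : ⨆ a, zetaSpan τ k a ≤
          (⨆ a, (SKModC τ (k + 1)).map (transC a)).comap constants.mkQ :=
        iSup_le fun a G hG => Submodule.mem_iSup_of_mem a (mkQ_mem_of_mem_zetaSpan hG)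
      exact hle hH
    have h3 := iSup_mono (fun a => Submodule.map_mono (SKModC_mono τ k.le_succ)) (ih h1)
    rw [← sub_add_cancel F H, map_add]
    exact add_mem h3 h2

theorem map_transC_le_KModC (τ : UpperHalfPlane) (k : ℕ) (a : ℂ) :
    (SKModC τ k).map (transC a) ≤ KModC τ k := by
  rintro _ ⟨x, hx, rfl⟩
  obtain ⟨F, hF, h, rfl⟩ := mem_SKModC.1 hx
  refine mem_KModC.2 ⟨trans a F, trans_mem_quasiElliptic hF.1, ?_, rfl⟩
  rw [diff_pow_trans]
  exact constants_le_trans a h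

/-- The quasi-elliptic functions all of whose poles have their class modulo `Λ` in `S`. -/
def polesIn (τ : UpperHalfPlane) (S : Set (ℂ ⧸ lattice τ)) : Submodule ℂ Mero where
  carrier := {F | F ∈ quasiElliptic τ ∧ ∀ z : ℂ, IsPole F z → (z : ℂ ⧸ lattice τ) ∈ S}
  zero_mem' := ⟨zero_mem _, fun z hz =>
    absurd hz (not_isPole_of_mem_constants (zero_mem _) z)⟩
  add_mem' := fun ⟨hF, hF'⟩ ⟨hG, hG'⟩ =>
    ⟨add_mem hF hG, fun z hz => hz.or_of_add.elim (hF' z) (hG' z)⟩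
  smul_mem' := fun c _ ⟨hF, hF'⟩ =>
    ⟨Submodule.smul_mem _ c hF, fun z hz => hF' z hz.of_smul⟩

theorem polesIn_mono {τ : UpperHalfPlane} {S T : Set (ℂ ⧸ lattice τ)} (h : S ⊆ T) :
    polesIn τ S ≤ polesIn τ T := fun _ hF => ⟨hF.1, fun z hz => h (hF.2 z hz)⟩

theorem map_transC_le_polesIn (τ : UpperHalfPlane) (k : ℕ) (a : ℂ) :
    (SKModC τ k).map (transC a) ≤ (polesIn τ {(a : ℂ ⧸ lattice τ)}).map constants.mkQ := by
  rintro _ ⟨x, hx, rfl⟩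
  obtain ⟨F, hF, -, rfl⟩ := mem_SKModC.1 hx
  refine ⟨trans a F, ⟨trans_mem_quasiElliptic hF.1, fun z hz => ?_⟩, rfl⟩
  rw [Set.mem_singleton_iff, eq_comm, QuotientAddGroup.eq, neg_add_eq_sub]
  exact hF.2 _ (isPole_trans.1 hz)

/-- If a function with poles in `S` and one with poles off `S` differ by a constant, then they have
no poles, hence are constant. -/
theorem disjoint_map_polesIn {τ : UpperHalfPlane} {S T : Set (ℂ ⧸ lattice τ)} (h : Disjoint S T) :
    Disjoint ((polesIn τ S).map constants.mkQ) ((polesIn τ T).map constants.mkQ) := by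
  rw [Submodule.disjoint_def]
  rintro _ ⟨F, hF, rfl⟩ ⟨G, hG, hFG⟩
  have hsub : G - F ∈ constants := (Submodule.Quotient.eq constants).1 hFG
  refine (Submodule.Quotient.mk_eq_zero _).2 (mem_constants_of_no_pole hF.1 fun z hz => ?_)
  exact Set.disjoint_left.1 h (hF.2 z hz)
    (hG.2 z ((isPole_iff_of_sub_mem_constants hsub z).2 hz))

end

end QuasiElliptic

/-- For `k ≥ 1` the space `T_a (SK_k/ℂ)` depends only on the class of `a` in `ℂ/Λ`, and `K_k/ℂ` is
the internal direct sum of these spaces over all points of `ℂ/Λ`. -/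
theorem mainTheorem2 (τ : UpperHalfPlane) (k : ℕ) (hk : 1 ≤ k) :
    ∃ W : ℂ ⧸ QuasiElliptic.lattice τ → Submodule ℂ QuasiElliptic.MeroModC,
      (∀ a : ℂ, W (QuotientAddGroup.mk a) =
        (QuasiElliptic.SKModC τ k).map (QuasiElliptic.transC a)) ∧
      iSupIndep W ∧ ⨆ x, W x = QuasiElliptic.KModC τ k := by
  open QuasiElliptic in
  have hW : ∀ a : ℂ, (SKModC τ k).map (transC (Quotient.out (a : ℂ ⧸ lattice τ))) =
      (SKModC τ k).map (transC a) := fun a => by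
    refine map_transC_eq_of_sub_mem k ?_
    rw [← neg_add_eq_sub, ← QuotientAddGroup.eq]
    exact (QuotientAddGroup.out_eq' _).symm
  -- The summand of a class is defined by a chosen representative; by `hW` any other gives the same.
  refine ⟨fun x => (QuasiElliptic.SKModC τ k).map (QuasiElliptic.transC x.out), hW,
    fun x => ?_, le_antisymm ?_ ?_⟩
  · have hle : ∀ y : ℂ ⧸ QuasiElliptic.lattice τ,
        (QuasiElliptic.SKModC τ k).map (QuasiElliptic.transC y.out) ≤
          (QuasiElliptic.polesIn τ {y}).map QuasiElliptic.constants.mkQ := fun y => by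
      have h := QuasiElliptic.map_transC_le_polesIn τ k y.out
      rwa [QuotientAddGroup.out_eq'] at h
    refine (QuasiElliptic.disjoint_map_polesIn (T := {x}ᶜ) (by simp)).mono (hle x) ?_
    exact iSup₂_le fun y hy => (hle y).trans
      (Submodule.map_mono (QuasiElliptic.polesIn_mono (by simpa using hy.symm)))
  · exact iSup_le fun x => QuasiElliptic.map_transC_le_KModC τ k _
  · refine (QuasiElliptic.KModC_le_iSup τ k).trans (iSup_le fun a => ?_)
    rw [← hW a]
    exact le_iSup (fun x : ℂ ⧸ QuasiElliptic.lattice τ =>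
      (QuasiElliptic.SKModC τ k).map (QuasiElliptic.transC x.out)) a
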